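/- Notation. $\mathcal M^c$ is the set of Borel probability measures $F$ on $\mathbb R^2$ with continuous margins, i.e. $F(\{x\}\times\mathbb R)=F(\mathbb R\times\{x\})=0$ for all $x\in\mathbb R$; $\mathcal M^c_+$ is the set of those $F\in\mathcal M^c$ with $F(\mathbb R^2\setminus[0,\infty)^2)=0$. Write $F(x,y)=F((-\infty,x]\times(-\infty,y])$, and $F_1,F_2$ for the marginal distribution functions. $F$ has square integrable margins if $\int (x^2+y^2)\,dF(x,y)<\infty$. A copula is a $C\in\mathcal M^c$ with $C([0,x]\times\mathbb R)=C(\mathbb R\times[0,x])=x$ for $0\le x\le 1$. A copula $C$ is a copula of a probability measure $H$ on $\mathbb R^2$ if $H(x,y)=C(H_1(x),H_2(y))$ for all $x,y\in\mathbb R$; for $H\in\mathcal M^c$ it exists and is unique, and is denoted $\mathcal T H$. For $\lambda>0$ let $\Psi(\lambda,F)=e^{-\lambda}\sum_{k=0}^\infty\frac{\lambda^k}{k!}F^{*k}$ with $F^{*0}=\delta_0$. Since $\Psi(\lambda,F)$ may have an atom at the origin, its copula need not be unique; below $\mathcal T\Psi(\lambda,F)$ stands for an arbitrary copula of $\Psi(\lambda,F)$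 (at least one exists), and each assertion holds for every choice of these copulas, with $G,\Lambda,u_0,v_0,L$ independent of the choice. Statement. Let $F\in\mathcal M^c$ have square integrable margins. Then there are $c,d\ge 0$ such that $G=\delta_{(c,d)}*F$ satisfies: $G\ne F$, $G\in\mathcal M^c$, $G$ has square integrable margins, $G\in\mathcal M^c_+$ if $F\in\mathcal M^c_+$, and $\mathcal T F=\mathcal T G$; but there is $\Lambda>0$ with $$\mathcal T\Psi(\lambda,F)\neq\mathcal T\Psi(\lambda,G)\qquad\text{for all }\lambda\ge\Lambda,$$ and, more precisely, there are $u_0,v_0\in(0,1)$ and $L>0$ with $$\lim_{\lambda\to\infty}\bigl|\mathcal T\Psi(\lambda,F)(u_0,v_0)-\mathcal T\Psi(\lambda,G)(u_0,v_0)\bigr|=L.$$ Consequently $\mathcal T(\Psi(\lambda,F))=\mathcal T(\Psi(\lambda,\mathcal T F))$ fails in general: there are $F\in\mathcal M^c_+$ with square integrable margins and $\Lambda>0$ such that $\mathcal T(\Psi(\lambda,F))\neq\mathcal T(\Psi(\lambda,\mathcal T F))$ for all $\lambda\ge\Lambda$. -/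

import Mathlib

open MeasureTheory Set Filter Topology

namespace CPPCopula

/-- Membership in `𝓜ᶜ`: a Borel probability measure on the plane with continuous margins. -/
def MemMc (F : Measure (ℝ × ℝ)) : Prop :=
  IsProbabilityMeasure F ∧
    ∀ x : ℝ, F ({x} ×ˢ univ) = 0 ∧ F (univ ×ˢ {x}) = 0

/-- Membership in `𝓜₊ᶜ`: in addition `F (ℝ² \ [0,∞)²) = 0`. -/
def MemMcPlus (F : Measure (ℝ × ℝ)) : Prop :=
  MemMc F ∧ F (Ici (0 : ℝ) ×ˢ Ici (0 : ℝ))ᶜ = 0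

/-- Square integrable margins: `∫ (x² + y²) dF(x,y) < ∞`. -/
def SqIntegrable (F : Measure (ℝ × ℝ)) : Prop :=
  Integrable (fun p : ℝ × ℝ => p.1 ^ 2 + p.2 ^ 2) F

/-- The (joint) distribution function `F(x,y) = F((-∞,x] × (-∞,y])`. -/
noncomputable def distFun (F : Measure (ℝ × ℝ)) (x y : ℝ) : ℝ :=
  F.real (Iic x ×ˢ Iic y)

/-- A (two-dimensional) copula, as a measure: both margins are uniform on `[0,1]`. -/
def IsCopula (C : Measure (ℝ × ℝ)) : Prop :=
  MemMc C ∧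
    ∀ x ∈ Icc (0 : ℝ) 1,
      C (Icc 0 x ×ˢ univ) = ENNReal.ofReal x ∧ C (univ ×ˢ Icc 0 x) = ENNReal.ofReal x

/-- `C` is a copula of `H`: `H(x,y) = C(H₁(x), H₂(y))` for all real `x, y`, with `H₁, H₂` the
marginal distribution functions. If the margins of `H` are not continuous, `H` can have several
copulas. -/
def HasCopula (H C : Measure (ℝ × ℝ)) : Prop :=
  IsCopula C ∧
    ∀ x y : ℝ, distFun H x y = distFun C (H.fst.real (Iic x)) (H.snd.real (Iic y))

/-- `𝒯 F = C`: the measure `C` is the one and only copula of `F`. -/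
def IsTheCopula (F C : Measure (ℝ × ℝ)) : Prop :=
  ∀ C' : Measure (ℝ × ℝ), HasCopula F C' ↔ C' = C

/-- `𝒯 H ≠ 𝒯 K`, for `H` and `K` whose copulas need not be unique: both have copulas, and
no copula of `H` is a copula of `K`. -/
def CopulasDiffer (H K : Measure (ℝ × ℝ)) : Prop :=
  (∃ C, HasCopula H C) ∧ (∃ D, HasCopula K D) ∧
    ∀ C D : Measure (ℝ × ℝ), HasCopula H C → HasCopula K D → C ≠ D

/-- The convolution powers `F^{∗k}`, with `F^{∗0} = δ₀`. -/
noncomputable def convPow (F : Measure (ℝ × ℝ)) : ℕ → Measure (ℝ × ℝ)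
  | 0 => Measure.dirac 0
  | k + 1 => Measure.conv F (convPow F k)

/-- `Ψ(lam, F) = e^{-lam} ∑ₖ (lam ^ k / k!) F^{∗k}`, the law at time `1` of the compound Poisson
process with intensity `lam` and jump distribution `F`. -/
noncomputable def Psi (lam : ℝ) (F : Measure (ℝ × ℝ)) : Measure (ℝ × ℝ) :=
  Measure.sum fun k : ℕ =>
    ENNReal.ofReal (Real.exp (-lam) * (lam ^ k / (k.factorial : ℝ))) • convPow F k

end CPPCopula

/-! Let `(X, Y)` have law `F`. The covariances of `Ψ(lam, F)` are `lam` times the uncentred second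
moments of `F`. After centring and scaling the coordinates by `√(lam E X²)` and `√(lam E Y²)`, the
law therefore tends, as `lam → ∞`, to the bivariate normal law with correlation `ρ(F) = E(XY) / √(E
X² · E Y²)` (`tendsto_normPsi`). Copulas do not change under increasing affine maps of the
coordinates and are Lipschitz, so every choice of copula of `Ψ(lam, F)` converges at `(Φ(x), Φ(y))`
to the normal distribution function at `(x, y)`, with `Φ` the standard normal distribution function
(`exists_bound_distFun_copula`). Since that normal law determines `ρ`, two jump laws with different
`ρ` have limits that differ at some point (`copulas_separate_of_corr_ne`).

It remains to change `ρ` without changing the copula. A translation by `(c, d)` preserves the copula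
but alters uncentred moments. If `ρ` were the same for all `c, d ≥ 0`, comparing polynomial
coefficients would force `ρ² = 1` and then `Var Y = 0`, against continuity of the margins
(`exists_corr_map_add_ne`).

Atoms of `Ψ(lam, F)` make it necessary to prove Sklar's existence theorem for arbitrary margins,
which is done with an auxiliary uniform variable. -/

namespace CPPCopula

/-! ### Uniform margins and elementary properties of copulas. -/

/-- The uniform distribution on the unit interval. -/
noncomputable def unif : Measure ℝ := volume.restrict (Icc 0 1)

instance : IsProbabilityMeasure unif := ⟨by simp [unif]⟩

lemma unif_Iic {u : ℝ} (hu : u ∈ Icc (0 : ℝ) 1) : unif (Iic u) = ENNReal.ofReal u := by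
  have : Iic u ∩ Icc 0 1 = Icc 0 u := by
    ext z; simp only [mem_inter_iff, mem_Iic, mem_Icc] at *; constructor
    · rintro ⟨h1, h2, h3⟩; exact ⟨h2, h1⟩
    · rintro ⟨h1, h2⟩; exact ⟨h2, h1, h2.trans hu.2⟩
  rw [unif, Measure.restrict_apply measurableSet_Iic, this, Real.volume_Icc, sub_zero]

lemma unif_real_Iic {u : ℝ} (hu : u ∈ Icc (0 : ℝ) 1) : unif.real (Iic u) = u := by
  rw [measureReal_def, unif_Iic hu, ENNReal.toReal_ofReal hu.1]

instance : NullSingletonClass unif := by unfold unif; infer_instance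

lemma unif_real_Iio {u : ℝ} (hu : u ∈ Icc (0 : ℝ) 1) : unif.real (Iio u) = u := by
  rw [measureReal_congr Iio_ae_eq_Iic, unif_real_Iic hu]

lemma eq_unif_of_Icc {μ : Measure ℝ} [IsProbabilityMeasure μ]
    (h : ∀ x ∈ Icc (0 : ℝ) 1, μ (Icc 0 x) = ENNReal.ofReal x) : μ = unif := by
  have h1 : μ (Icc 0 1) = 1 := by simpa using h 1 (by simp)
  have h2 : ∀ᵐ x ∂μ, x ∈ Icc (0 : ℝ) 1 := (prob_compl_eq_zero_iff measurableSet_Icc).2 h1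
  rw [← Measure.restrict_eq_self_of_ae_mem h2, unif]
  refine Measure.ext_of_Iic _ _ fun a => ?_
  rw [Measure.restrict_apply measurableSet_Iic, Measure.restrict_apply measurableSet_Iic]
  have hs : Iic a ∩ Icc 0 1 = Icc 0 (min a 1) := by
    ext z; simp only [mem_inter_iff, mem_Iic, mem_Icc, le_min_iff]; tauto
  rw [hs]
  rcases le_or_gt 0 a with ha | ha
  · rw [h _ ⟨by positivity, min_le_right _ _⟩, Real.volume_Icc, sub_zero]
  · rw [Icc_eq_empty (by simp [ha])]; simp

/-- Open half-lines are what `map_distTransform` computes. Monotonicity extends the values beyond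
`(0, 1)`, and limits from the right give the closed half-lines. -/
lemma eq_unif_of_Iio {ν : Measure ℝ} [IsProbabilityMeasure ν]
    (h : ∀ u ∈ Ioo (0 : ℝ) 1, ν.real (Iio u) = u) : ν = unif := by
  have key : ∀ u, ν.real (Iio u) = max 0 (min u 1) := by
    intro u
    rcases le_or_gt u 0 with hu | hu
    · rw [max_eq_left (by simp [hu])]
      refine le_antisymm (le_of_forall_pos_le_add fun ε hε => ?_) measureReal_nonneg
      have h3 : min ε (1 / 2) ∈ Ioo (0 : ℝ) 1 :=
        ⟨by positivity, (min_le_right _ _).trans_lt (by norm_num)⟩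
      calc ν.real (Iio u) ≤ ν.real (Iio (min ε (1 / 2))) :=
            measureReal_mono (Iio_subset_Iio (hu.trans h3.1.le))
        _ = _ := h _ h3
        _ ≤ _ := by simp
    rcases lt_or_ge u 1 with h1 | h1
    · rw [h u ⟨hu, h1⟩, min_eq_left h1.le, max_eq_right hu.le]
    · rw [min_eq_right h1, max_eq_right zero_le_one]
      refine le_antisymm measureReal_le_one (le_of_forall_pos_le_add fun ε hε => ?_)
      have h3 : 1 - min ε (1 / 2) ∈ Ioo (0 : ℝ) 1 := by
        have := min_le_right ε (1 / 2)
        have : 0 < min ε (1 / 2) := by positivity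
        constructor <;> linarith
      have h4 : ν.real (Iio (1 - min ε (1 / 2))) ≤ ν.real (Iio u) :=
            measureReal_mono (Iio_subset_Iio (h3.2.le.trans h1))
      rw [h _ h3] at h4
      linarith [min_le_left ε (1 / 2)]
  refine eq_unif_of_Icc fun x hx => ?_
  have hmeas : Tendsto (fun n : ℕ => ν.real (Iio (x + 1 / ((n : ℝ) + 1)))) atTop
      (𝓝 (ν.real (⋂ n : ℕ, Iio (x + 1 / ((n : ℝ) + 1))))) := by
    refine (ENNReal.tendsto_toReal (measure_ne_top _ _)).comp
      (tendsto_measure_iInter_atTop (fun n => measurableSet_Iio.nullMeasurableSet) ?_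
        ⟨0, measure_ne_top _ _⟩)
    intro m n hmn
    exact Iio_subset_Iio (add_le_add_right (Nat.one_div_le_one_div hmn) x)
  have hI : (⋂ n : ℕ, Iio (x + 1 / ((n : ℝ) + 1))) = Iic x := by
    ext z
    simp only [mem_iInter, mem_Iio, mem_Iic]
    refine ⟨fun hz => le_of_forall_pos_le_add fun ε hε => ?_, fun hz n => ?_⟩
    · obtain ⟨n, hn⟩ := exists_nat_one_div_lt hε
      linarith [hz n]
    · have := Nat.one_div_pos_of_nat (α := ℝ) (n := n); linarith
  rw [hI] at hmeas
  have hlim : Tendsto (fun n : ℕ => ν.real (Iio (x + 1 / ((n : ℝ) + 1)))) atTop (𝓝 x) := by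
    simp_rw [key]
    have : Tendsto (fun n : ℕ => max 0 (min (x + 1 / ((n : ℝ) + 1)) 1)) atTop
        (𝓝 (max 0 (min (x + 0) 1))) :=
      tendsto_const_nhds.max ((tendsto_const_nhds.add
        tendsto_one_div_add_atTop_nhds_zero_nat).min tendsto_const_nhds)
    rwa [add_zero, min_eq_left hx.2, max_eq_right hx.1] at this
  have hIic := tendsto_nhds_unique hmeas hlim
  have h0 : ν.real (Iio 0) = 0 := by rw [key]; simp
  have h5 : ν.real (Icc 0 x) = x := by
    have hd : Disjoint (Iio 0) (Icc 0 x) :=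
      Set.disjoint_left.2 fun z hz hz' => absurd hz (not_lt.2 hz'.1)
    have := measureReal_union (μ := ν) hd measurableSet_Icc
    rwa [Iio_union_Icc_eq_Iic hx.1, h0, zero_add, hIic, eq_comm] at this
  rw [← h5, ofReal_measureReal, h5]

lemma isCopula_iff {C : Measure (ℝ × ℝ)} : IsCopula C ↔ C.fst = unif ∧ C.snd = unif := by
  constructor
  · rintro ⟨⟨hp, -⟩, h⟩
    refine ⟨eq_unif_of_Icc fun x hx => ?_, eq_unif_of_Icc fun x hx => ?_⟩
    · rw [Measure.fst_apply measurableSet_Icc, ← prod_univ, (h x hx).1]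
    · rw [Measure.snd_apply measurableSet_Icc, ← univ_prod, (h x hx).2]
  · rintro ⟨h1, h2⟩
    have hi : ∀ x ∈ Icc (0 : ℝ) 1, unif (Icc 0 x) = ENNReal.ofReal x := by
      intro x hx
      rw [unif, Measure.restrict_apply measurableSet_Icc, inter_eq_left.2
        (Icc_subset_Icc_right hx.2), Real.volume_Icc, sub_zero]
    refine ⟨⟨⟨?_⟩, fun x => ⟨?_, ?_⟩⟩, fun x hx => ⟨?_, ?_⟩⟩
    · rw [← Measure.fst_univ, h1, measure_univ]
    · rw [prod_univ, ← Measure.fst_apply (measurableSet_singleton x), h1, measure_singleton]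
    · rw [univ_prod, ← Measure.snd_apply (measurableSet_singleton x), h2, measure_singleton]
    · rw [prod_univ, ← Measure.fst_apply measurableSet_Icc, h1, hi x hx]
    · rw [univ_prod, ← Measure.snd_apply measurableSet_Icc, h2, hi x hx]

lemma measure_ext_of_distFun {μ ν : Measure (ℝ × ℝ)} [IsProbabilityMeasure μ]
    [IsProbabilityMeasure ν] (h : ∀ x y, distFun μ x y = distFun ν x y) : μ = ν := by
  have hb : (inferInstance : MeasurableSpace ℝ) = MeasurableSpace.generateFrom (range Iic) := by
    exact (borel_eq_generateFrom_Iic ℝ ▸ BorelSpace.measurable_eq)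
  have hspan : IsCountablySpanning (range (Iic : ℝ → Set ℝ)) := by
    refine ⟨fun n : ℕ => Iic (n : ℝ), fun n => mem_range_self _, ?_⟩
    exact iUnion_eq_univ_iff.2 fun x => exists_nat_ge x
  refine ext_of_generate_finite (image2 (· ×ˢ ·) (range Iic) (range Iic))
    (generateFrom_eq_prod hb.symm hb.symm hspan hspan).symm
    (isPiSystem_Iic.prod isPiSystem_Iic) ?_ (by simp)
  rintro - ⟨-, ⟨x, rfl⟩, -, ⟨y, rfl⟩, rfl⟩
  have := h x y
  simpa [distFun, measureReal_def, ENNReal.toReal_eq_toReal_iff'] using this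

lemma HasCopula.isProbabilityMeasure {H C : Measure (ℝ × ℝ)} (h : HasCopula H C) :
    IsProbabilityMeasure C := h.1.1.1

/-- An increment in one argument is the mass of part of a strip, and a strip has mass equal to its
width because the margins are uniform. The bound serves twice: for density arguments in
`HasCopula.unique`, and to absorb the error of the margins in the limit theorem. -/
lemma IsCopula.abs_distFun_sub_le {C : Measure (ℝ × ℝ)} (hC : IsCopula C) {u u' v v' : ℝ}
    (hu : u ∈ Icc (0 : ℝ) 1) (hu' : u' ∈ Icc (0 : ℝ) 1) (hv : v ∈ Icc (0 : ℝ) 1)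
    (hv' : v' ∈ Icc (0 : ℝ) 1) :
    |distFun C u v - distFun C u' v'| ≤ |u - u'| + |v - v'| := by
  have : IsProbabilityMeasure C := hC.1.1
  obtain ⟨h1, h2⟩ := isCopula_iff.1 hC
  have e1 : ∀ a ∈ Icc (0 : ℝ) 1, C.real (Iic a ×ˢ univ) = a := fun a ha => by
    rw [prod_univ, measureReal_def, ← Measure.fst_apply measurableSet_Iic, h1, ← measureReal_def,
      unif_real_Iic ha]
  have e2 : ∀ a ∈ Icc (0 : ℝ) 1, C.real (univ ×ˢ Iic a) = a := fun a ha => by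
    rw [univ_prod, measureReal_def, ← Measure.snd_apply measurableSet_Iic, h2, ← measureReal_def,
      unif_real_Iic ha]
  have hms : ∀ a b : ℝ, MeasurableSet (Iic a ×ˢ Iic b) := fun a b =>
    measurableSet_Iic.prod measurableSet_Iic
  have k1 : ∀ a ∈ Icc (0 : ℝ) 1, ∀ b ∈ Icc (0 : ℝ) 1, a ≤ b → ∀ w,
      |distFun C b w - distFun C a w| ≤ b - a := by
    intro a ha b hb hab w
    have hsub : Iic a ×ˢ Iic w ⊆ Iic b ×ˢ Iic w := prod_mono (Iic_subset_Iic.2 hab) subset_rfl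
    have hsub' : (Iic a ×ˢ univ : Set (ℝ × ℝ)) ⊆ Iic b ×ˢ univ :=
      prod_mono (Iic_subset_Iic.2 hab) subset_rfl
    rw [distFun, distFun, abs_of_nonneg (sub_nonneg.2 (measureReal_mono hsub)),
      ← measureReal_sdiff hsub (hms _ _)]
    nth_rw 2 [← e1 a ha, ← e1 b hb]
    rw [← measureReal_sdiff hsub' (measurableSet_Iic.prod .univ)]
    refine measureReal_mono ?_
    rintro ⟨p, q⟩; simp only [Set.mem_sdiff, mem_prod, mem_Iic, mem_univ, and_true]; tauto
  have k2 : ∀ a ∈ Icc (0 : ℝ) 1, ∀ b ∈ Icc (0 : ℝ) 1, a ≤ b → ∀ w,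
      |distFun C w b - distFun C w a| ≤ b - a := by
    intro a ha b hb hab w
    have hsub : Iic w ×ˢ Iic a ⊆ Iic w ×ˢ Iic b := prod_mono subset_rfl (Iic_subset_Iic.2 hab)
    have hsub' : (univ ×ˢ Iic a : Set (ℝ × ℝ)) ⊆ univ ×ˢ Iic b :=
      prod_mono subset_rfl (Iic_subset_Iic.2 hab)
    rw [distFun, distFun, abs_of_nonneg (sub_nonneg.2 (measureReal_mono hsub)),
      ← measureReal_sdiff hsub (hms _ _)]
    nth_rw 2 [← e2 a ha, ← e2 b hb]
    rw [← measureReal_sdiff hsub' (MeasurableSet.univ.prod measurableSet_Iic)]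
    refine measureReal_mono ?_
    rintro ⟨p, q⟩; simp only [Set.mem_sdiff, mem_prod, mem_Iic, mem_univ, true_and]; tauto
  refine (abs_sub_le _ (distFun C u' v) _).trans (add_le_add ?_ ?_)
  · rcases le_total u u' with h | h
    · rw [abs_sub_comm, abs_sub_comm u, abs_of_nonneg (sub_nonneg.2 h)]; exact k1 _ hu _ hu' h v
    · rw [abs_of_nonneg (sub_nonneg.2 h)]; exact k1 _ hu' _ hu h v
  · rcases le_total v v' with h | h
    · rw [abs_sub_comm, abs_sub_comm v, abs_of_nonneg (sub_nonneg.2 h)]; exact k2 _ hv _ hv' h u'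
    · rw [abs_of_nonneg (sub_nonneg.2 h)]; exact k2 _ hv' _ hv h u'

/-- Copulas are invariant under strictly increasing affine changes of the coordinates. -/
lemma HasCopula.map_affine {H C : Measure (ℝ × ℝ)} (h : HasCopula H C) {a a' : ℝ} (b b' : ℝ)
    (ha : 0 < a) (ha' : 0 < a') :
    HasCopula (H.map fun p => (a * p.1 + b, a' * p.2 + b')) C := by
  refine ⟨h.1, fun x y => ?_⟩
  have hm : Measurable fun p : ℝ × ℝ => (a * p.1 + b, a' * p.2 + b') := by fun_prop
  have hiff : ∀ {a b : ℝ}, 0 < a → ∀ t x, a * t + b ≤ x ↔ t ≤ (x - b) / a := by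
    intro a b ha t x
    rw [le_div_iff₀ ha, mul_comm, le_sub_iff_add_le]
  have e1 : distFun (H.map fun p => (a * p.1 + b, a' * p.2 + b')) x y
      = distFun H ((x - b) / a) ((y - b') / a') := by
    rw [distFun, map_measureReal_apply hm (measurableSet_Iic.prod measurableSet_Iic), distFun]
    congr 1
    ext p
    simp only [mem_preimage, mem_prod, mem_Iic, hiff ha, hiff ha']
  have e2 : (H.map fun p => (a * p.1 + b, a' * p.2 + b')).fst.real (Iic x)
      = H.fst.real (Iic ((x - b) / a)) := by
    rw [Measure.fst, Measure.map_map measurable_fst hm, Measure.fst,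
      map_measureReal_apply (measurable_fst.comp hm) measurableSet_Iic,
      map_measureReal_apply measurable_fst measurableSet_Iic]
    congr 1
    ext p
    simp [hiff ha]
  have e3 : (H.map fun p => (a * p.1 + b, a' * p.2 + b')).snd.real (Iic y)
      = H.snd.real (Iic ((y - b') / a')) := by
    rw [Measure.snd, Measure.map_map measurable_snd hm, Measure.snd,
      map_measureReal_apply (measurable_snd.comp hm) measurableSet_Iic,
      map_measureReal_apply measurable_snd measurableSet_Iic]
    congr 1
    ext p
    simp [hiff ha']
  rw [e1, e2, e3, h.2]

/-! ### Sklar's theorem through the distributional transform. -/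

/-- The distributional transform `F(x-) + v (F(x) - F(x-))` of a distribution on the line. -/
noncomputable def distTransform (μ : Measure ℝ) (q : ℝ × ℝ) : ℝ :=
  μ.real (Iio q.1) + q.2 * μ.real {q.1}

lemma real_Iic_eq (μ : Measure ℝ) [IsFiniteMeasure μ] (x : ℝ) :
    μ.real (Iic x) = μ.real (Iio x) + μ.real {x} := by
  rw [← Iio_union_right, measureReal_union (by simp) (measurableSet_singleton x)]

lemma measurable_distTransform (μ : Measure ℝ) [IsFiniteMeasure μ] :
    Measurable (distTransform μ) := by
  have h1 : Measurable fun x => μ.real (Iio x) :=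
    Monotone.measurable fun x y h => measureReal_mono (Iio_subset_Iio h)
  have h2 : Measurable fun x => μ.real {x} := by
    have : (fun x => μ.real {x}) = fun x => μ.real (Iic x) - μ.real (Iio x) := by
      ext x; rw [real_Iic_eq]; ring
    rw [this]
    exact (Monotone.measurable fun x y h => measureReal_mono (Iic_subset_Iic.2 h)).sub h1
  exact (h1.comp measurable_fst).add (measurable_snd.mul (h2.comp measurable_fst))

lemma distTransform_le (μ : Measure ℝ) [IsFiniteMeasure μ] {q : ℝ × ℝ} (hq : q.2 ≤ 1) :
    distTransform μ q ≤ μ.real (Iic q.1) := by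
  rw [distTransform, real_Iic_eq]
  gcongr
  exact mul_le_of_le_one_left measureReal_nonneg hq

lemma le_distTransform (μ : Measure ℝ) {q : ℝ × ℝ} (hq : 0 ≤ q.2) :
    μ.real (Iio q.1) ≤ distTransform μ q :=
  le_add_of_nonneg_right (mul_nonneg hq measureReal_nonneg)

lemma ae_snd_mem_Icc (μ : Measure ℝ) [IsProbabilityMeasure μ] :
    ∀ᵐ q ∂μ.prod unif, q.2 ∈ Icc (0 : ℝ) 1 := by
  have h : ∀ᵐ v ∂unif, v ∈ Icc (0 : ℝ) 1 := ae_restrict_mem measurableSet_Icc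
  exact Measure.quasiMeasurePreserving_snd.ae h

lemma tendsto_real_Iic_atBot (μ : Measure ℝ) [IsProbabilityMeasure μ] :
    Tendsto (fun x => μ.real (Iic x)) atBot (𝓝 0) := by
  simp_rw [← ProbabilityTheory.cdf_eq_real]
  exact ProbabilityTheory.tendsto_cdf_atBot μ

lemma tendsto_real_Iic_atTop (μ : Measure ℝ) [IsProbabilityMeasure μ] :
    Tendsto (fun x => μ.real (Iic x)) atTop (𝓝 1) := by
  simp_rw [← ProbabilityTheory.cdf_eq_real]
  exact ProbabilityTheory.tendsto_cdf_atTop μ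

/-- Existence of quantiles. -/
lemma exists_quantile (μ : Measure ℝ) [IsProbabilityMeasure μ] {u : ℝ} (hu : u ∈ Ioo (0 : ℝ) 1) :
    ∃ x, (∀ y < x, μ.real (Iic y) < u) ∧ μ.real (Iio x) ≤ u ∧ u ≤ μ.real (Iic x) := by
  set S := {x | u ≤ μ.real (Iic x)} with hS
  have hne : S.Nonempty :=
    ((tendsto_real_Iic_atTop μ).eventually (lt_mem_nhds hu.2)).exists.imp fun x hx => hx.le
  have hbdd : BddBelow S := by
    obtain ⟨x, hx⟩ := ((tendsto_real_Iic_atBot μ).eventually (gt_mem_nhds hu.1)).exists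
    refine ⟨x, fun y hy => le_of_not_gt fun hlt => ?_⟩
    exact absurd (measureReal_mono (μ := μ) (Iic_subset_Iic.2 hlt.le))
      (not_le.2 (hx.trans_le hy))
  have hlt : ∀ y < sInf S, μ.real (Iic y) < u := fun y hy =>
    not_le.1 fun h => absurd (csInf_le hbdd h) (not_le.2 hy)
  refine ⟨sInf S, hlt, ?_, ?_⟩
  · have : Tendsto (fun y => μ.real (Iic y)) (𝓝[<] sInf S) (𝓝 (μ.real (Iio (sInf S)))) := by
      have := (ProbabilityTheory.cdf μ).mono.tendsto_leftLim (sInf S)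
      have h2 : Function.leftLim (ProbabilityTheory.cdf μ) (sInf S) = μ.real (Iio (sInf S)) := by
        have h3 := (ProbabilityTheory.cdf μ).measure_Iio
          (ProbabilityTheory.tendsto_cdf_atBot μ) (sInf S)
        rw [ProbabilityTheory.measure_cdf] at h3
        rw [measureReal_def, h3, sub_zero, ENNReal.toReal_ofReal]
        exact (ProbabilityTheory.cdf_nonneg μ (sInf S - 1)).trans
          ((ProbabilityTheory.cdf μ).mono.le_leftLim (by linarith))
      rw [h2] at this
      simp_rw [← ProbabilityTheory.cdf_eq_real]
      exact this
    refine le_of_tendsto this ?_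
    filter_upwards [self_mem_nhdsWithin] with y hy using (hlt y hy).le
  · have : Tendsto (fun y => μ.real (Iic y)) (𝓝[>] sInf S) (𝓝 (μ.real (Iic (sInf S)))) := by
      have := ((ProbabilityTheory.cdf μ).right_continuous (sInf S)).mono_left
        (nhdsWithin_mono _ Ioi_subset_Ici_self)
      simp_rw [← ProbabilityTheory.cdf_eq_real]
      exact this
    refine ge_of_tendsto this ?_
    filter_upwards [self_mem_nhdsWithin] with y hy
    obtain ⟨z, hz, hzy⟩ := exists_lt_of_csInf_lt hne hy
    exact le_trans (show u ≤ _ from hz) (measureReal_mono (Iic_subset_Iic.2 hzy.le))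

/-- Randomising inside the atoms fills the jumps of the distribution function. With `x` the
`u`-quantile, the event that the transform is below `u` is almost surely `{X < x}` together with the
part of the atom at `x` where the auxiliary uniform is below `(u - F(x-)) / F{x}`. The total mass is
`u`. -/
lemma map_distTransform (μ : Measure ℝ) [IsProbabilityMeasure μ] :
    (μ.prod unif).map (distTransform μ) = unif := by
  have hm := measurable_distTransform μ
  have : IsProbabilityMeasure ((μ.prod unif).map (distTransform μ)) :=
    Measure.isProbabilityMeasure_map hm.aemeasurable
  refine eq_unif_of_Iio fun u hu => ?_
  rw [map_measureReal_apply hm measurableSet_Iio]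
  obtain ⟨x, hx, hx1, hx2⟩ := exists_quantile μ hu
  have hset : (distTransform μ ⁻¹' Iio u : Set (ℝ × ℝ)) =ᵐ[μ.prod unif]
      (Iio x ×ˢ univ ∪ {x} ×ˢ {v | μ.real (Iio x) + v * μ.real {x} < u} : Set (ℝ × ℝ)) := by
    filter_upwards [ae_snd_mem_Icc μ] with q hq
    apply propext
    change distTransform μ q < u ↔
      q ∈ Iio x ×ˢ univ ∪ {x} ×ˢ {v | μ.real (Iio x) + v * μ.real {x} < u}
    simp only [mem_union, mem_prod, mem_Iio, mem_univ, and_true, mem_singleton_iff, mem_ofPred_eq]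
    rcases lt_trichotomy q.1 x with h | h | h
    · simp only [h, true_or, iff_true]
      exact (distTransform_le μ hq.2).trans_lt (hx _ h)
    · simp [h, distTransform]
    · simp only [not_lt.2 h.le, h.ne', false_and, or_false, iff_false, not_lt]
      refine hx2.trans (le_trans ?_ (le_distTransform μ hq.1))
      exact measureReal_mono fun z hz => lt_of_le_of_lt hz h
  have hms : MeasurableSet {v : ℝ | μ.real (Iio x) + v * μ.real {x} < u} :=
    measurableSet_lt (by fun_prop) measurable_const
  rw [measureReal_congr hset, measureReal_union _ ((measurableSet_singleton x).prod hms),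
    measureReal_prod_prod, measureReal_prod_prod, probReal_univ, mul_one]
  · rw [real_Iic_eq] at hx2
    -- Without an atom at `x` the quantile bounds already give `F(x-) = u`.
    rcases (measureReal_nonneg (μ := μ) (s := {x})).eq_or_lt' with h0 | h0
    · rw [h0] at hx2 ⊢; linarith
    · have hs : {v : ℝ | μ.real (Iio x) + v * μ.real {x} < u}
          = Iio ((u - μ.real (Iio x)) / μ.real {x}) := by
        ext v; simp only [mem_ofPred_eq, mem_Iio, lt_div_iff₀ h0, lt_sub_iff_add_lt']
      rw [hs, unif_real_Iio, mul_div_cancel₀ _ h0.ne']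
      · ring
      · exact ⟨div_nonneg (by linarith) h0.le, (div_le_one h0).2 (by linarith)⟩
  · rw [Set.disjoint_left]
    rintro q ⟨hq, -⟩ ⟨hq', -⟩
    exact absurd hq' (ne_of_lt hq)

/-- Monotonicity gives only the implication from right to left. Both events have probability `F(x)`,
since the transform is uniform, so they agree almost surely. -/
lemma ae_distTransform_le_iff (μ : Measure ℝ) [IsProbabilityMeasure μ] (x : ℝ) :
    ∀ᵐ q ∂μ.prod unif, distTransform μ q ≤ μ.real (Iic x) ↔ q.1 ≤ x := by
  have hm := measurable_distTransform μ
  have h1 : (Prod.fst ⁻¹' Iic x : Set (ℝ × ℝ)) ≤ᵐ[μ.prod unif]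
      (distTransform μ ⁻¹' Iic (μ.real (Iic x)) : Set (ℝ × ℝ)) := by
    filter_upwards [ae_snd_mem_Icc μ] with q hq hqx
    exact (distTransform_le μ hq.2).trans (measureReal_mono (Iic_subset_Iic.2 hqx))
  have h2 : (μ.prod unif) (distTransform μ ⁻¹' Iic (μ.real (Iic x)))
      ≤ (μ.prod unif) (Prod.fst ⁻¹' Iic x) := by
    rw [← Measure.map_apply hm measurableSet_Iic, map_distTransform,
      unif_Iic ⟨measureReal_nonneg, measureReal_le_one⟩, ofReal_measureReal, ← prod_univ,
      Measure.prod_prod, measure_univ, mul_one]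
  have h3 := ae_eq_of_ae_subset_of_measure_ge h1 h2
    (measurable_fst measurableSet_Iic).nullMeasurableSet (measure_ne_top _ _)
  filter_upwards [h3] with q hq
  exact (iff_of_eq hq).symm

/-- **Sklar's theorem**, existence: every distribution on the plane has a copula. -/
theorem exists_hasCopula (H : Measure (ℝ × ℝ)) [IsProbabilityMeasure H] :
    ∃ C, HasCopula H C := by
  -- One auxiliary uniform serves both coordinates: only its independence of each coordinate
  -- separately enters.
  set f : (ℝ × ℝ) × ℝ → ℝ × ℝ := fun q => (q.1.1, q.2) with hf
  set g : (ℝ × ℝ) × ℝ → ℝ × ℝ := fun q => (q.1.2, q.2) with hg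
  have mf : Measurable f := by fun_prop
  have mg : Measurable g := by fun_prop
  have ef : (H.prod unif).map f = H.fst.prod unif := by
    rw [show f = Prod.map Prod.fst id from rfl, ← Measure.map_prod_map _ _ measurable_fst
      measurable_id, Measure.map_id, Measure.fst]
  have eg : (H.prod unif).map g = H.snd.prod unif := by
    rw [show g = Prod.map Prod.snd id from rfl, ← Measure.map_prod_map _ _ measurable_snd
      measurable_id, Measure.map_id, Measure.snd]
  have m1 : Measurable fun q => distTransform H.fst (f q) :=
    (measurable_distTransform H.fst).comp mf
  have m2 : Measurable fun q => distTransform H.snd (g q) :=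
    (measurable_distTransform H.snd).comp mg
  refine ⟨(H.prod unif).map fun q => (distTransform H.fst (f q), distTransform H.snd (g q)),
    isCopula_iff.2 ⟨?_, ?_⟩, fun x y => ?_⟩
  · rw [Measure.fst_map_prodMk m2]
    change (H.prod unif).map (distTransform H.fst ∘ f) = _
    rw [← Measure.map_map (measurable_distTransform _) mf, ef, map_distTransform]
  · rw [Measure.snd_map_prodMk m1]
    change (H.prod unif).map (distTransform H.snd ∘ g) = _
    rw [← Measure.map_map (measurable_distTransform _) mg, eg, map_distTransform]
  · have h1 := ae_of_ae_map mf.aemeasurable (ef ▸ ae_distTransform_le_iff H.fst x)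
    have h2 := ae_of_ae_map mg.aemeasurable (eg ▸ ae_distTransform_le_iff H.snd y)
    rw [distFun, distFun, map_measureReal_apply (m1.prodMk m2)
      (measurableSet_Iic.prod measurableSet_Iic)]
    have h3 : ((fun q => (distTransform H.fst (f q), distTransform H.snd (g q))) ⁻¹'
        Iic (H.fst.real (Iic x)) ×ˢ Iic (H.snd.real (Iic y)) : Set ((ℝ × ℝ) × ℝ))
        =ᵐ[H.prod unif] ((Iic x ×ˢ Iic y) ×ˢ univ : Set ((ℝ × ℝ) × ℝ)) := by
      filter_upwards [h1, h2] with q hq1 hq2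
      apply propext
      change _ ∧ _ ↔ (_ ∧ _) ∧ _
      simp only [mem_univ, and_true]
      exact and_congr hq1 hq2
    rw [measureReal_congr h3, measureReal_prod_prod, probReal_univ, mul_one]

/-- **Sklar's theorem**, uniqueness: with continuous margins there is only one copula. -/
theorem HasCopula.unique {H C D : Measure (ℝ × ℝ)} (hH : MemMc H) (hC : HasCopula H C)
    (hD : HasCopula H D) : C = D := by
  have := hH.1
  have := hC.isProbabilityMeasure
  have := hD.isProbabilityMeasure
  have hsurj : ∀ (μ : Measure ℝ) [IsProbabilityMeasure μ] (_ : ∀ x, μ {x} = 0),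
      ∀ u ∈ Ioo (0 : ℝ) 1, ∃ x, μ.real (Iic x) = u := by
    intro μ _ hμ u hu
    obtain ⟨x, -, h1, h2⟩ := exists_quantile μ hu
    refine ⟨x, le_antisymm ?_ h2⟩
    rwa [real_Iic_eq, measureReal_def μ {x}, hμ, ENNReal.toReal_zero, add_zero]
  -- Continuous marginal distribution functions attain every value in `(0, 1)`, so `H` prescribes
  -- the copula on the open square. The Lipschitz bound carries this to the closed square.
  have key : ∀ u ∈ Ioo (0 : ℝ) 1, ∀ v ∈ Ioo (0 : ℝ) 1, distFun C u v = distFun D u v := by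
    intro u hu v hv
    obtain ⟨x, rfl⟩ := hsurj H.fst (fun x => by
      rw [Measure.fst_apply (measurableSet_singleton x), ← prod_univ]; exact (hH.2 x).1) u hu
    obtain ⟨y, rfl⟩ := hsurj H.snd (fun x => by
      rw [Measure.snd_apply (measurableSet_singleton x), ← univ_prod]; exact (hH.2 x).2) v hv
    rw [← hC.2, ← hD.2]
  have hI : ∀ᵐ v ∂unif, v ∈ Ioo (0 : ℝ) 1 := by
    have : (Ioo 0 1 : Set ℝ) =ᵐ[volume] Icc 0 1 := Ioo_ae_eq_Icc
    rw [unif, ← Measure.restrict_congr_set this]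
    exact ae_restrict_mem measurableSet_Ioo
  have hcl : ∀ u ∈ Icc (0 : ℝ) 1, ∀ v ∈ Icc (0 : ℝ) 1, distFun C u v = distFun D u v := by
    intro u hu v hv
    have approx : ∀ u ∈ Icc (0 : ℝ) 1, ∀ ε > 0, ∃ w ∈ Ioo (0 : ℝ) 1, |u - w| ≤ ε := by
      intro u hu ε hε
      have : u ∈ closure (Ioo (0 : ℝ) 1) := by rwa [closure_Ioo zero_ne_one]
      obtain ⟨w, hw, h⟩ := Metric.mem_closure_iff.1 this ε hε
      exact ⟨w, hw, by rw [← Real.dist_eq]; exact h.le⟩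
    rw [← sub_eq_zero, ← abs_eq_zero]
    refine le_antisymm (le_of_forall_pos_le_add fun ε hε => ?_) (abs_nonneg _)
    obtain ⟨u', hu', h1⟩ := approx u hu (ε / 4) (by positivity)
    obtain ⟨v', hv', h2⟩ := approx v hv (ε / 4) (by positivity)
    have h3 := hC.1.abs_distFun_sub_le hu (Ioo_subset_Icc_self hu') hv (Ioo_subset_Icc_self hv')
    have h4 := hD.1.abs_distFun_sub_le hu (Ioo_subset_Icc_self hu') hv (Ioo_subset_Icc_self hv')
    rw [key u' hu' v' hv'] at h3
    rw [abs_le] at h3 h4 ⊢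
    constructor <;> linarith [h3.1, h3.2, h4.1, h4.2]
  -- A copula is carried by the unit square, so its distribution function elsewhere is recovered
  -- from its values there.
  have trunc : ∀ C : Measure (ℝ × ℝ), IsCopula C → ∀ u v,
      distFun C u v = if 0 ≤ u ∧ 0 ≤ v then distFun C (min u 1) (min v 1) else 0 := by
    intro C hC u v
    have := hC.1.1
    obtain ⟨h1, h2⟩ := isCopula_iff.1 hC
    have a1 : ∀ᵐ p ∂C, p.1 ∈ Ioo (0 : ℝ) 1 := ae_of_ae_map measurable_fst.aemeasurable
      (by rw [← Measure.fst, h1]; exact hI)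
    have a2 : ∀ᵐ p ∂C, p.2 ∈ Ioo (0 : ℝ) 1 := ae_of_ae_map measurable_snd.aemeasurable
      (by rw [← Measure.snd, h2]; exact hI)
    split_ifs with huv
    · refine measureReal_congr ?_
      filter_upwards [a1, a2] with p hp1 hp2
      apply propext
      change _ ∧ _ ↔ _ ∧ _
      simp [hp1.2.le, hp2.2.le]
    · rw [distFun, measureReal_def, ENNReal.toReal_eq_zero_iff]
      left
      rw [measure_eq_zero_iff_ae_notMem]
      filter_upwards [a1, a2] with p hp1 hp2 hp
      exact huv ⟨hp1.1.le.trans hp.1, hp2.1.le.trans hp.2⟩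
  refine measure_ext_of_distFun fun u v => ?_
  rw [trunc C hC.1, trunc D hD.1]
  split_ifs with h
  · exact hcl _ ⟨le_min h.1 zero_le_one, min_le_right _ _⟩ _
      ⟨le_min h.2 zero_le_one, min_le_right _ _⟩
  · rfl

theorem exists_isTheCopula {H : Measure (ℝ × ℝ)} (hH : MemMc H) : ∃ C, IsTheCopula H C := by
  have := hH.1
  obtain ⟨C, hC⟩ := exists_hasCopula H
  exact ⟨C, fun C' => ⟨fun h => h.unique hH hC, fun h => h ▸ hC⟩⟩

/-! ### Characteristic functions of compound Poisson laws and their limits. -/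

open ProbabilityTheory in
/-- Convergence of characteristic functions on the plane entails convergence of the measures of
continuity sets of the limit. -/
lemma tendsto_measureReal_of_charFunDual {μ : ℕ → Measure (ℝ × ℝ)}
    [∀ n, IsProbabilityMeasure (μ n)] {ν : Measure (ℝ × ℝ)} [IsProbabilityMeasure ν]
    (h : ∀ L : StrongDual ℝ (ℝ × ℝ),
      Tendsto (fun n => charFunDual (μ n) L) atTop (𝓝 (charFunDual ν L)))
    {S : Set (ℝ × ℝ)} (hS : ν (frontier S) = 0) :
    Tendsto (fun n => (μ n).real S) atTop (𝓝 (ν.real S)) := by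
  -- `charFun` uses an inner product, so the measures are moved to the Euclidean plane and back by a
  -- linear homeomorphism.
  let e := WithLp.prodContinuousLinearEquiv 2 ℝ ℝ ℝ
  let f : (ℝ × ℝ) →L[ℝ] WithLp 2 (ℝ × ℝ) := e.symm
  let P : ℕ → ProbabilityMeasure (ℝ × ℝ) := fun n => ⟨μ n, inferInstance⟩
  let Q : ProbabilityMeasure (ℝ × ℝ) := ⟨ν, inferInstance⟩
  have hf : ∀ R : ProbabilityMeasure (ℝ × ℝ), AEMeasurable f R := fun R =>
    f.continuous.aemeasurable
  have h1 : Tendsto (fun n => (P n).map (hf (P n))) atTop (𝓝 (Q.map (hf Q))) := by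
    refine ProbabilityMeasure.tendsto_of_tendsto_charFun fun t => ?_
    have key : ∀ R : ProbabilityMeasure (ℝ × ℝ), charFun (R.map (hf R) : Measure _) t
        = charFunDual (R : Measure (ℝ × ℝ)) ((InnerProductSpace.toDualMap ℝ _ t).comp f) := by
      intro R
      rw [charFun_eq_charFunDual_toDualMap, ProbabilityMeasure.toMeasure_map, charFunDual_map]
    simp_rw [key]
    exact h _
  have h2 := ProbabilityMeasure.tendsto_map_of_tendsto_of_continuous _ _ h1 e.continuous
  have back : ∀ R : ProbabilityMeasure (ℝ × ℝ),
      (R.map (hf R)).map e.continuous.aemeasurable = R := by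
    intro R
    apply Subtype.ext
    change ((R : Measure (ℝ × ℝ)).map f).map e = R
    rw [Measure.map_map e.continuous.measurable f.continuous.measurable]
    have : (e ∘ f : ℝ × ℝ → ℝ × ℝ) = id := by
      ext x : 1
      exact e.apply_symm_apply x
    rw [this, Measure.map_id]
  simp only [back] at h2
  have h3 := ProbabilityMeasure.tendsto_measure_of_null_frontier_of_tendsto' h2 (E := S) hS
  exact (ENNReal.tendsto_toReal (measure_ne_top _ _)).comp h3

instance (F : Measure (ℝ × ℝ)) [IsProbabilityMeasure F] (k : ℕ) :
    IsProbabilityMeasure (convPow F k) := by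
  induction k with
  | zero => exact inferInstanceAs (IsProbabilityMeasure (Measure.dirac 0))
  | succ k ih => exact inferInstanceAs (IsProbabilityMeasure (Measure.conv F (convPow F k)))

lemma charFunDual_convPow (F : Measure (ℝ × ℝ)) [IsProbabilityMeasure F] (k : ℕ)
    (L : StrongDual ℝ (ℝ × ℝ)) : charFunDual (convPow F k) L = charFunDual F L ^ k := by
  induction k with
  | zero => simp [convPow, charFunDual_dirac]
  | succ k ih => rw [convPow, charFunDual_conv, ih, pow_succ']

lemma hasSum_poisson (lam : ℝ) :
    HasSum (fun k : ℕ => Real.exp (-lam) * (lam ^ k / (k.factorial : ℝ))) 1 := by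
  have := (NormedSpace.expSeries_div_hasSum_exp lam).mul_left (Real.exp (-lam))
  rwa [← Real.exp_eq_exp_ℝ, ← Real.exp_add, neg_add_cancel, Real.exp_zero] at this

lemma isProbabilityMeasure_Psi (F : Measure (ℝ × ℝ)) [IsProbabilityMeasure F] {lam : ℝ}
    (hl : 0 ≤ lam) : IsProbabilityMeasure (Psi lam F) := by
  refine ⟨?_⟩
  rw [Psi, Measure.sum_apply _ .univ]
  simp only [Measure.smul_apply, measure_univ, smul_eq_mul, mul_one]
  rw [← ENNReal.ofReal_tsum_of_nonneg (fun k => by positivity) (hasSum_poisson lam).summable,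
    (hasSum_poisson lam).tsum_eq, ENNReal.ofReal_one]

lemma charFunDual_Psi (F : Measure (ℝ × ℝ)) [IsProbabilityMeasure F] {lam : ℝ}
    (hl : 0 ≤ lam) (L : StrongDual ℝ (ℝ × ℝ)) :
    charFunDual (Psi lam F) L = Complex.exp (lam * (charFunDual F L - 1)) := by
  have := isProbabilityMeasure_Psi F hl
  have hint : Integrable (fun v => Complex.exp (L v * Complex.I)) (Psi lam F) := by
    refine Integrable.of_bound (C := 1) (by fun_prop) (ae_of_all _ fun v => ?_)
    rw [Complex.norm_exp_ofReal_mul_I]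
  have h1 := hasSum_integral_measure hint
  have h2 : ∀ k : ℕ, ∫ v, Complex.exp (L v * Complex.I)
      ∂(ENNReal.ofReal (Real.exp (-lam) * (lam ^ k / (k.factorial : ℝ))) • convPow F k)
      = Complex.exp (-lam) * ((lam * charFunDual F L) ^ k / (k.factorial : ℂ)) := by
    intro k
    rw [integral_smul_measure, ← charFunDual_apply, charFunDual_convPow,
      ENNReal.toReal_ofReal (by positivity), Complex.real_smul]
    push_cast
    ring
  simp_rw [h2] at h1
  have h3 := (NormedSpace.expSeries_div_hasSum_exp (lam * charFunDual F L)).mul_left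
    (Complex.exp (-lam))
  rw [← Complex.exp_eq_exp_ℂ, ← Complex.exp_add] at h3
  rw [charFunDual_apply]
  exact (h1.unique h3).trans (by congr 1; ring)

lemma SqIntegrable.memLp_fst {F : Measure (ℝ × ℝ)} (hF : SqIntegrable F) :
    MemLp Prod.fst 2 F := by
  rw [memLp_two_iff_integrable_sq (by fun_prop)]
  refine Integrable.mono' hF (by fun_prop) (ae_of_all _ fun p => ?_)
  rw [Real.norm_of_nonneg (sq_nonneg _)]
  exact le_add_of_nonneg_right (sq_nonneg _)

lemma SqIntegrable.memLp_snd {F : Measure (ℝ × ℝ)} (hF : SqIntegrable F) :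
    MemLp Prod.snd 2 F := by
  rw [memLp_two_iff_integrable_sq (by fun_prop)]
  refine Integrable.mono' hF (by fun_prop) (ae_of_all _ fun p => ?_)
  rw [Real.norm_of_nonneg (sq_nonneg _)]
  exact le_add_of_nonneg_left (sq_nonneg _)

lemma dual_apply_eq (L : StrongDual ℝ (ℝ × ℝ)) (p : ℝ × ℝ) :
    L p = L (1, 0) * p.1 + L (0, 1) * p.2 := by
  have : p = p.1 • ((1 : ℝ), (0 : ℝ)) + p.2 • ((0 : ℝ), (1 : ℝ)) := by ext <;> simp
  nth_rw 1 [this]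
  rw [map_add, map_smul, map_smul, smul_eq_mul, smul_eq_mul]
  ring

lemma SqIntegrable.memLp_dual {F : Measure (ℝ × ℝ)} (hF : SqIntegrable F)
    (L : StrongDual ℝ (ℝ × ℝ)) : MemLp L 2 F := by
  rw [show (L : ℝ × ℝ → ℝ) = fun p => L (1, 0) * p.1 + L (0, 1) * p.2 from
    funext (dual_apply_eq L)]
  exact (hF.memLp_fst.const_mul _).add (hF.memLp_snd.const_mul _)

open Asymptotics in
/-- Second order expansion at the origin of the characteristic function. -/
lemma SqIntegrable.isLittleO_charFunDual {F : Measure (ℝ × ℝ)} [IsProbabilityMeasure F]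
    (hF : SqIntegrable F) (L : StrongDual ℝ (ℝ × ℝ)) :
    (fun t : ℝ => charFunDual F (t • L)
      - (1 + (∫ p, L p ∂F : ℝ) * t * Complex.I - (∫ p, L p ^ 2 ∂F : ℝ) * t ^ 2 / 2))
      =o[𝓝 0] fun t => t ^ 2 := by
  -- Along a fixed `L` the question concerns the law of `L` on the line, whose second moment is
  -- finite, so its characteristic function is twice continuously differentiable.
  have hL : MemLp id 2 (F.map L) := (memLp_map_measure_iff (by fun_prop) (by fun_prop)).2
    (hF.memLp_dual L)
  have : IsProbabilityMeasure (F.map L) := Measure.isProbabilityMeasure_map (by fun_prop)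
  have h := taylor_isLittleO_univ (contDiff_charFun (n := 2) hL) (x₀ := (0 : ℝ))
  simp_rw [taylorWithinEval_charFun_two_zero L.continuous.aemeasurable hL,
    charFun_map_eq_charFunDual_smul] at h
  simpa using h

/-- The image of `Ψ(lam, F)` under the centring and scaling of the central limit theorem, with
scales `s₁`, `s₂` for the two coordinates. -/
noncomputable def normPsi (lam s₁ s₂ : ℝ) (F : Measure (ℝ × ℝ)) : Measure (ℝ × ℝ) :=
  (Psi lam F).map fun p =>
    ((√lam * s₁)⁻¹ * p.1 + -(√lam * (s₁⁻¹ * ∫ p, p.1 ∂F)),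
      (√lam * s₂)⁻¹ * p.2 + -(√lam * (s₂⁻¹ * ∫ p, p.2 ∂F)))

/-- Scaling moves into the functional, with `L'` absorbing `s₁`, `s₂`, and centring becomes the
phase `-√lam E L'`. -/
lemma charFunDual_normPsi {F : Measure (ℝ × ℝ)} [IsProbabilityMeasure F] (hF : SqIntegrable F)
    {lam : ℝ} (hl : 0 ≤ lam) (s₁ s₂ : ℝ) (L L' : StrongDual ℝ (ℝ × ℝ))
    (hL' : ∀ p, L' p = L (s₁⁻¹ * p.1, s₂⁻¹ * p.2)) :
    charFunDual (normPsi lam s₁ s₂ F) L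
      = Complex.exp (lam * (charFunDual F ((√lam)⁻¹ • L') - 1)
        - √lam * (∫ p, L' p ∂F : ℝ) * Complex.I) := by
  rw [sub_eq_add_neg, Complex.exp_add, ← charFunDual_Psi F hl, charFunDual_apply, normPsi,
    integral_map (by fun_prop) (by fun_prop), charFunDual_apply, ← integral_mul_const]
  refine integral_congr_ae (ae_of_all _ fun p => ?_)
  have hm : ∫ p, L' p ∂F = L (s₁⁻¹ * ∫ p, p.1 ∂F, s₂⁻¹ * ∫ p, p.2 ∂F) := by
    simp_rw [hL']
    rw [integral_congr_ae (ae_of_all F fun p : ℝ × ℝ =>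
        dual_apply_eq L (s₁⁻¹ * p.1, s₂⁻¹ * p.2)),
      dual_apply_eq L (s₁⁻¹ * ∫ p, p.1 ∂F, _), integral_add, integral_const_mul, integral_const_mul, integral_const_mul,
      integral_const_mul]
    · exact ((hF.memLp_fst.integrable (by norm_num)).const_mul _).const_mul _
    · exact ((hF.memLp_snd.integrable (by norm_num)).const_mul _).const_mul _
  simp only
  rw [← Complex.exp_add, hm, smul_apply, hL',
    dual_apply_eq L (s₁⁻¹ * ∫ p, p.1 ∂F, _), dual_apply_eq L (s₁⁻¹ * p.1, _),
    dual_apply_eq L ((√lam * s₁)⁻¹ * p.1 + _, _), smul_eq_mul]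
  congr 1
  push_cast
  rw [mul_inv, mul_inv]
  ring

/-- In the expansion of `lam (φ(1/√lam) - 1)` the linear term is exactly cancelled by the centring
phase. The uncentred second moment of `L'` survives, not the variance. -/
lemma tendsto_charFunDual_normPsi {F : Measure (ℝ × ℝ)} [IsProbabilityMeasure F]
    (hF : SqIntegrable F) (s₁ s₂ : ℝ) (L : StrongDual ℝ (ℝ × ℝ)) :
    Tendsto (fun lam => charFunDual (normPsi lam s₁ s₂ F) L) atTop
      (𝓝 (Complex.exp (-((∫ p, L (s₁⁻¹ * p.1, s₂⁻¹ * p.2) ^ 2 ∂F : ℝ) : ℂ) / 2))) := by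
  let L' : StrongDual ℝ (ℝ × ℝ) := L.comp
    ((s₁⁻¹ • ContinuousLinearMap.fst ℝ ℝ ℝ).prod (s₂⁻¹ • ContinuousLinearMap.snd ℝ ℝ ℝ))
  have hL' : ∀ p, L' p = L (s₁⁻¹ * p.1, s₂⁻¹ * p.2) := fun p => rfl
  have ht : Tendsto (fun lam : ℝ => (√lam)⁻¹) atTop (𝓝 0) :=
    tendsto_inv_atTop_zero.comp Real.tendsto_sqrt_atTop
  have h1 := (hF.isLittleO_charFunDual L').comp_tendsto ht
  have h2 : Tendsto (fun lam : ℝ => (lam : ℂ) * (charFunDual F ((√lam)⁻¹ • L')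
      - (1 + (∫ p, L' p ∂F : ℝ) * ((√lam)⁻¹ : ℝ) * Complex.I
        - (∫ p, L' p ^ 2 ∂F : ℝ) * ((√lam)⁻¹ : ℝ) ^ 2 / 2))) atTop (𝓝 0) := by
    have h3 := h1.tendsto_inv_smul_nhds_zero
    refine h3.congr' ?_
    filter_upwards [eventually_gt_atTop 0] with lam hl
    simp only [Function.comp_apply]
    rw [inv_pow, Real.sq_sqrt hl.le, inv_inv, Complex.real_smul]
  have h3 := h2.add_const (-((∫ p, L' p ^ 2 ∂F : ℝ) : ℂ) / 2)
  rw [zero_add] at h3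
  refine ((Complex.continuous_exp.tendsto _).comp h3).congr' ?_
  filter_upwards [eventually_gt_atTop 0] with lam hl
  rw [charFunDual_normPsi hF hl.le s₁ s₂ L L' hL', Function.comp_apply]
  congr 1
  have hs : (√lam : ℂ) ≠ 0 := by
    simpa using (Real.sqrt_pos.2 hl).ne'
  have hs2 : (lam : ℂ) = (√lam : ℂ) ^ 2 := by
    rw [← Complex.ofReal_pow, Real.sq_sqrt hl.le]
  rw [hs2]
  push_cast
  field_simp
  ring

/-! ### The bivariate normal limit law. -/

open ProbabilityTheory in
/-- The bivariate normal distribution with standard margins and correlation `r`. -/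
noncomputable def gaussPair (r : ℝ) : Measure (ℝ × ℝ) :=
  ((gaussianReal 0 1).prod (gaussianReal 0 1)).map fun p => (p.1, r * p.1 + √(1 - r ^ 2) * p.2)

instance (r : ℝ) : IsProbabilityMeasure (gaussPair r) :=
  Measure.isProbabilityMeasure_map (by fun_prop)

-- The functional becomes a combination of two independent standard normals with weights `L (1, 0) +
-- r * L (0, 1)` and `√(1 - r ^ 2) * L (0, 1)`, whose squares add up to the quadratic form. The
-- bound on `r` keeps `√` away from negative arguments.
open ProbabilityTheory in
lemma charFunDual_gaussPair {r : ℝ} (hr : r ^ 2 ≤ 1) (L : StrongDual ℝ (ℝ × ℝ)) :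
    charFunDual (gaussPair r) L
      = Complex.exp (-((L (1, 0) ^ 2 + 2 * r * L (1, 0) * L (0, 1) + L (0, 1) ^ 2 : ℝ) : ℂ) / 2) := by
  rw [charFunDual_apply, gaussPair, integral_map (by fun_prop) (by fun_prop)]
  have h1 : ∀ p : ℝ × ℝ, Complex.exp (L (p.1, r * p.1 + √(1 - r ^ 2) * p.2) * Complex.I)
      = Complex.exp (((L (1, 0) + r * L (0, 1) : ℝ) : ℂ) * p.1 * Complex.I)
        * Complex.exp (((√(1 - r ^ 2) * L (0, 1) : ℝ) : ℂ) * p.2 * Complex.I) := by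
    intro p
    rw [← Complex.exp_add, dual_apply_eq L (p.1, _)]
    congr 1
    push_cast
    ring
  simp_rw [h1]
  rw [integral_prod_mul
    (fun x : ℝ => Complex.exp (((L (1, 0) + r * L (0, 1) : ℝ) : ℂ) * x * Complex.I))
    (fun x : ℝ => Complex.exp (((√(1 - r ^ 2) * L (0, 1) : ℝ) : ℂ) * x * Complex.I)),
    ← charFun_apply_real, ← charFun_apply_real, charFun_gaussianReal, charFun_gaussianReal,
    ← Complex.exp_add]
  congr 1
  have hs : ((√(1 - r ^ 2) : ℝ) : ℂ) ^ 2 = 1 - (r : ℂ) ^ 2 := by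
    rw [← Complex.ofReal_pow, Real.sq_sqrt (by linarith)]; push_cast; ring
  push_cast
  rw [mul_pow, hs]
  ring

open ProbabilityTheory in
lemma fst_gaussPair (r : ℝ) : (gaussPair r).fst = gaussianReal 0 1 := by
  rw [gaussPair, Measure.fst_map_prodMk (by fun_prop), ← Measure.fst, Measure.fst_prod]

open ProbabilityTheory in
lemma snd_gaussPair {r : ℝ} (hr : r ^ 2 ≤ 1) : (gaussPair r).snd = gaussianReal 0 1 := by
  refine Measure.ext_of_charFun (funext fun t => ?_)
  have h : charFun (gaussPair r).snd t
      = charFunDual (gaussPair r) (t • ContinuousLinearMap.snd ℝ ℝ ℝ) := by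
    rw [charFun_apply_real, charFunDual_apply, Measure.snd,
      integral_map (by fun_prop) (by fun_prop)]
    simp
  rw [h, charFunDual_gaussPair hr, charFun_gaussianReal]
  simp [neg_div]

lemma memMc_gaussPair {r : ℝ} (hr : r ^ 2 ≤ 1) : MemMc (gaussPair r) := by
  have := ProbabilityTheory.nullSingletonClass_gaussianReal (μ := 0) (v := 1) one_ne_zero
  refine ⟨inferInstance, fun x => ⟨?_, ?_⟩⟩
  · rw [prod_univ, ← Measure.fst_apply (measurableSet_singleton x), fst_gaussPair,
      measure_singleton]
  · rw [univ_prod, ← Measure.snd_apply (measurableSet_singleton x), snd_gaussPair hr,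
      measure_singleton]

/-- The sum of the coordinates has variance `2 + 2r`, which reveals `r`. -/
lemma gaussPair_injOn {r r' : ℝ} (hr : r ^ 2 ≤ 1) (hr' : r' ^ 2 ≤ 1)
    (h : gaussPair r = gaussPair r') : r = r' := by
  have h1 := charFunDual_gaussPair hr
    (ContinuousLinearMap.fst ℝ ℝ ℝ + ContinuousLinearMap.snd ℝ ℝ ℝ)
  rw [h, charFunDual_gaussPair hr', ← Complex.ofReal_neg, ← Complex.ofReal_neg] at h1
  norm_cast at h1
  have := Real.exp_injective h1
  simp at this
  linarith

lemma exists_distFun_gaussPair_ne {r r' : ℝ} (hr : r ^ 2 ≤ 1) (hr' : r' ^ 2 ≤ 1) (h : r ≠ r') :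
    ∃ x y, distFun (gaussPair r) x y ≠ distFun (gaussPair r') x y := by
  by_contra! hc
  exact h (gaussPair_injOn hr hr' (measure_ext_of_distFun hc))

lemma frontier_prod_Iic_subset (x y : ℝ) :
    frontier (Iic x ×ˢ Iic y) ⊆ ({x} ×ˢ univ ∪ univ ×ˢ {y} : Set (ℝ × ℝ)) := by
  rw [frontier_prod_eq, frontier_Iic, frontier_Iic]
  rintro p (⟨-, h⟩ | ⟨h, -⟩)
  · exact Or.inr ⟨mem_univ _, h⟩
  · exact Or.inl ⟨h, mem_univ _⟩

lemma MemMc.measure_frontier_prod_Iic {F : Measure (ℝ × ℝ)} (hF : MemMc F) (x y : ℝ) :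
    F (frontier (Iic x ×ˢ Iic y)) = 0 :=
  measure_mono_null (frontier_prod_Iic_subset x y)
    (measure_union_null (hF.2 x).1 (hF.2 y).2)

lemma MemMc.measure_frontier_Iic_univ {F : Measure (ℝ × ℝ)} (hF : MemMc F) (x : ℝ) :
    F (frontier (Iic x ×ˢ univ)) = 0 := by
  rw [frontier_prod_univ_eq, frontier_Iic]
  exact (hF.2 x).1

lemma MemMc.measure_frontier_univ_Iic {F : Measure (ℝ × ℝ)} (hF : MemMc F) (x : ℝ) :
    F (frontier (univ ×ˢ Iic x)) = 0 := by
  rw [frontier_univ_prod_eq, frontier_Iic]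
  exact (hF.2 x).2

/-! ### Second moments and the uncentred correlation. -/

/-- The root of the second moment of the first coordinate. -/
noncomputable def scale₁ (F : Measure (ℝ × ℝ)) : ℝ := √(∫ p, p.1 ^ 2 ∂F)

/-- The root of the second moment of the second coordinate. -/
noncomputable def scale₂ (F : Measure (ℝ × ℝ)) : ℝ := √(∫ p, p.2 ^ 2 ∂F)

/-- The (uncentred) correlation coefficient. -/
noncomputable def corr (F : Measure (ℝ × ℝ)) : ℝ := (∫ p, p.1 * p.2 ∂F) / (scale₁ F * scale₂ F)

variable {F : Measure (ℝ × ℝ)}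

lemma integral_fst_sq_pos (hF : MemMc F) (h2 : SqIntegrable F) : 0 < ∫ p, p.1 ^ 2 ∂F := by
  have := hF.1
  rw [integral_pos_iff_support_of_nonneg (fun p => sq_nonneg _) h2.memLp_fst.integrable_sq]
  have : (Function.support fun p : ℝ × ℝ => p.1 ^ 2) = ({0} ×ˢ univ)ᶜ := by
    ext p; simp
  rw [this, prob_compl_eq_one_sub ((measurableSet_singleton _).prod .univ), (hF.2 0).1]
  simp

lemma integral_snd_sq_pos (hF : MemMc F) (h2 : SqIntegrable F) : 0 < ∫ p, p.2 ^ 2 ∂F := by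
  have := hF.1
  rw [integral_pos_iff_support_of_nonneg (fun p => sq_nonneg _) h2.memLp_snd.integrable_sq]
  have : (Function.support fun p : ℝ × ℝ => p.2 ^ 2) = (univ ×ˢ {0})ᶜ := by
    ext p; simp
  rw [this, prob_compl_eq_one_sub (MeasurableSet.univ.prod (measurableSet_singleton _)),
    (hF.2 0).2]
  simp

lemma scale₁_pos (hF : MemMc F) (h2 : SqIntegrable F) : 0 < scale₁ F :=
  Real.sqrt_pos.2 (integral_fst_sq_pos hF h2)

lemma scale₂_pos (hF : MemMc F) (h2 : SqIntegrable F) : 0 < scale₂ F :=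
  Real.sqrt_pos.2 (integral_snd_sq_pos hF h2)

lemma scale₁_sq : scale₁ F ^ 2 = ∫ p, p.1 ^ 2 ∂F :=
  Real.sq_sqrt (integral_nonneg fun _ => sq_nonneg _)

lemma scale₂_sq : scale₂ F ^ 2 = ∫ p, p.2 ^ 2 ∂F :=
  Real.sq_sqrt (integral_nonneg fun _ => sq_nonneg _)

lemma SqIntegrable.integrable_mul (h2 : SqIntegrable F) : Integrable (fun p => p.1 * p.2) F :=
  h2.memLp_fst.integrable_mul h2.memLp_snd

/-- This matches the exponent in `tendsto_charFunDual_normPsi` with that of `charFunDual_gaussPair`.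
Its nonnegativity at `(1, ±1)` bounds the correlation. -/
lemma integral_scaled_sq (hF : MemMc F) (h2 : SqIntegrable F) (a b : ℝ) :
    ∫ p, (a * ((scale₁ F)⁻¹ * p.1) + b * ((scale₂ F)⁻¹ * p.2)) ^ 2 ∂F
      = a ^ 2 + 2 * corr F * a * b + b ^ 2 := by
  have i1 := h2.memLp_fst.integrable_sq
  have i2 := h2.memLp_snd.integrable_sq
  have i3 := h2.integrable_mul
  have s1 := scale₁_pos hF h2
  have s2 := scale₂_pos hF h2
  have e : ∀ p : ℝ × ℝ, (a * ((scale₁ F)⁻¹ * p.1) + b * ((scale₂ F)⁻¹ * p.2)) ^ 2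
      = a ^ 2 / scale₁ F ^ 2 * p.1 ^ 2 + 2 * a * b / (scale₁ F * scale₂ F) * (p.1 * p.2)
        + b ^ 2 / scale₂ F ^ 2 * p.2 ^ 2 := by
    intro p; field_simp; ring
  simp_rw [e]
  have i13 : Integrable (fun p : ℝ × ℝ => a ^ 2 / scale₁ F ^ 2 * p.1 ^ 2
      + 2 * a * b / (scale₁ F * scale₂ F) * (p.1 * p.2)) F :=
    (i1.const_mul _).add (i3.const_mul _)
  rw [integral_add i13 (i2.const_mul _),
    integral_add (i1.const_mul _) (i3.const_mul _), integral_const_mul, integral_const_mul,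
    integral_const_mul, ← scale₁_sq, ← scale₂_sq, corr]
  field_simp

lemma corr_sq_le_one (hF : MemMc F) (h2 : SqIntegrable F) : corr F ^ 2 ≤ 1 := by
  have h1 := integral_scaled_sq hF h2 1 1
  have h3 := integral_scaled_sq hF h2 1 (-1)
  have h4 : 0 ≤ 1 ^ 2 + 2 * corr F * 1 * 1 + 1 ^ 2 := h1 ▸ integral_nonneg fun _ => sq_nonneg _
  have h5 : 0 ≤ 1 ^ 2 + 2 * corr F * 1 * (-1) + (-1) ^ 2 :=
    h3 ▸ integral_nonneg fun _ => sq_nonneg _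
  rw [sq_le_one_iff_abs_le_one, abs_le]
  constructor <;> linarith

/-! ### Convergence of the normalised laws and of their copulas. -/

/-- The central limit theorem for compound Poisson distributions with large intensity. -/
lemma tendsto_normPsi (hF : MemMc F) (h2 : SqIntegrable F) {S : Set (ℝ × ℝ)}
    (hS : gaussPair (corr F) (frontier S) = 0) :
    Tendsto (fun lam => (normPsi lam (scale₁ F) (scale₂ F) F).real S) atTop
      (𝓝 ((gaussPair (corr F)).real S)) := by
  have := hF.1
  refine tendsto_of_seq_tendsto fun l hl => ?_
  -- Truncation at `0` makes every term a probability measure and changes only finitely many of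
  -- them.
  have hprob : ∀ n, IsProbabilityMeasure (normPsi (max (l n) 0) (scale₁ F) (scale₂ F) F) := by
    intro n
    have := isProbabilityMeasure_Psi F (le_max_right (l n) 0)
    exact Measure.isProbabilityMeasure_map (by fun_prop)
  have hmax : ∀ᶠ n in atTop, max (l n) 0 = l n :=
    (hl.eventually_ge_atTop 0).mono fun n hn => max_eq_left hn
  have hl' : Tendsto (fun n => max (l n) 0) atTop atTop :=
    hl.congr' (hmax.mono fun n hn => hn.symm)
  refine (tendsto_measureReal_of_charFunDual
    (μ := fun n => normPsi (max (l n) 0) (scale₁ F) (scale₂ F) F) (fun L => ?_) hS).congr' ?_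
  · rw [charFunDual_gaussPair (corr_sq_le_one hF h2), ← integral_scaled_sq hF h2]
    simp_rw [← fun p : ℝ × ℝ => dual_apply_eq L ((scale₁ F)⁻¹ * p.1, (scale₂ F)⁻¹ * p.2)]
    exact (tendsto_charFunDual_normPsi h2 _ _ L).comp hl'
  · filter_upwards [hmax] with n hn
    rw [Function.comp_apply, hn]

/-- The copulas of `Ψ(lam, F)` converge to the Gaussian copula, uniformly over all choices. -/
lemma exists_bound_distFun_copula (hF : MemMc F) (h2 : SqIntegrable F) (x y : ℝ) :
    ∃ e : ℝ → ℝ, Tendsto e atTop (𝓝 0) ∧ ∀ lam > 0, ∀ C, HasCopula (Psi lam F) C →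
      |distFun C ((ProbabilityTheory.gaussianReal 0 1).real (Iic x))
        ((ProbabilityTheory.gaussianReal 0 1).real (Iic y))
        - distFun (gaussPair (corr F)) x y| ≤ e lam := by
  have := hF.1
  have hr := corr_sq_le_one hF h2
  have hG := memMc_gaussPair hr
  set u := (ProbabilityTheory.gaussianReal 0 1).real (Iic x) with hu
  set v := (ProbabilityTheory.gaussianReal 0 1).real (Iic y) with hv
  set N : ℝ → Measure (ℝ × ℝ) := fun lam => normPsi lam (scale₁ F) (scale₂ F) F with hN
  have t0 := tendsto_normPsi hF h2 (hG.measure_frontier_prod_Iic x y)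
  have t1 := tendsto_normPsi hF h2 (hG.measure_frontier_Iic_univ x)
  have t2 := tendsto_normPsi hF h2 (hG.measure_frontier_univ_Iic y)
  have fst_eq : ∀ (μ : Measure (ℝ × ℝ)) z, μ.real (Iic z ×ˢ univ) = μ.fst.real (Iic z) :=
    fun μ z => by rw [measureReal_def, measureReal_def, Measure.fst_apply measurableSet_Iic,
      prod_univ]
  have snd_eq : ∀ (μ : Measure (ℝ × ℝ)) z, μ.real (univ ×ˢ Iic z) = μ.snd.real (Iic z) :=
    fun μ z => by rw [measureReal_def, measureReal_def, Measure.snd_apply measurableSet_Iic,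
      univ_prod]
  simp_rw [fst_eq, fst_gaussPair] at t1
  simp_rw [snd_eq, snd_gaussPair hr] at t2
  -- The bound involves the normalised law but not the copula, whence the uniformity over all
  -- choices: the first two terms pay for replacing the margins of `N lam` by normal ones.
  refine ⟨fun lam => (|u - (N lam).fst.real (Iic x)| + |v - (N lam).snd.real (Iic y)|)
    + |distFun (N lam) x y - distFun (gaussPair (corr F)) x y|, ?_, fun lam hl C hC => ?_⟩
  · have a1 := (tendsto_const_nhds (x := u)).sub t1
    have a2 := (tendsto_const_nhds (x := v)).sub t2
    have a0 := t0.sub_const (distFun (gaussPair (corr F)) x y)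
    have := (a1.abs.add a2.abs).add a0.abs
    simpa [hu, hv, distFun] using this
  · have hP := isProbabilityMeasure_Psi F hl.le
    have hNp : IsProbabilityMeasure (N lam) := Measure.isProbabilityMeasure_map (by fun_prop)
    have hsq := Real.sqrt_pos.2 hl
    have hC' : HasCopula (N lam) C := hC.map_affine _ _
      (inv_pos.2 (mul_pos hsq (scale₁_pos hF h2))) (inv_pos.2 (mul_pos hsq (scale₂_pos hF h2)))
    refine (abs_sub_le _ (distFun (N lam) x y) _).trans (add_le_add_left ?_ _)
    rw [hC'.2]
    exact hC.1.abs_distFun_sub_le ⟨measureReal_nonneg, measureReal_le_one⟩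
      ⟨measureReal_nonneg, measureReal_le_one⟩ ⟨measureReal_nonneg, measureReal_le_one⟩
      ⟨measureReal_nonneg, measureReal_le_one⟩

lemma gaussianReal_real_Iic_mem_Ioo (x : ℝ) :
    (ProbabilityTheory.gaussianReal 0 1).real (Iic x) ∈ Ioo (0 : ℝ) 1 := by
  have key : ∀ s : Set ℝ, volume s ≠ 0 → 0 < (ProbabilityTheory.gaussianReal 0 1).real s := by
    intro s hs
    refine ENNReal.toReal_pos (fun h => hs ?_) (measure_ne_top _ _)
    exact ProbabilityTheory.gaussianReal_absolutelyContinuous' 0 one_ne_zero h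
  refine ⟨key _ (by simp), ?_⟩
  have h := key (Ioi x) (by simp)
  rw [← compl_Iic, probReal_compl_eq_one_sub measurableSet_Iic] at h
  linarith

/-! ### Translations of the jump law and their effect on moments. -/

lemma dirac_conv_eq [IsProbabilityMeasure F] (c d : ℝ) :
    Measure.conv (Measure.dirac (c, d)) F = F.map fun p => (p.1 + c, p.2 + d) := by
  rw [Measure.dirac_conv]
  congr 1
  ext p <;> simp [add_comm]

lemma MemMc.map_add (hF : MemMc F) (c d : ℝ) : MemMc (F.map fun p => (p.1 + c, p.2 + d)) := by
  have := hF.1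
  have hm : Measurable fun p : ℝ × ℝ => (p.1 + c, p.2 + d) := by fun_prop
  refine ⟨Measure.isProbabilityMeasure_map hm.aemeasurable, fun x => ⟨?_, ?_⟩⟩
  · rw [Measure.map_apply hm ((measurableSet_singleton x).prod .univ), ← (hF.2 (x - c)).1]
    congr 1
    ext p
    simp [eq_sub_iff_add_eq]
  · rw [Measure.map_apply hm (MeasurableSet.univ.prod (measurableSet_singleton x)),
      ← (hF.2 (x - d)).2]
    congr 1
    ext p
    simp [eq_sub_iff_add_eq]

lemma MemMcPlus.map_add (hF : MemMcPlus F) {c d : ℝ} (hc : 0 ≤ c) (hd : 0 ≤ d) :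
    MemMcPlus (F.map fun p => (p.1 + c, p.2 + d)) := by
  refine ⟨hF.1.map_add c d, ?_⟩
  rw [Measure.map_apply (by fun_prop) (measurableSet_Ici.prod measurableSet_Ici).compl]
  refine measure_mono_null ?_ hF.2
  rw [preimage_compl, compl_subset_compl]
  rintro p ⟨h1, h2⟩
  exact ⟨add_nonneg h1 hc, add_nonneg h2 hd⟩

lemma SqIntegrable.map_add [IsProbabilityMeasure F] (h2 : SqIntegrable F) (c d : ℝ) :
    SqIntegrable (F.map fun p => (p.1 + c, p.2 + d)) := by
  rw [SqIntegrable, integrable_map_measure (by fun_prop) (by fun_prop)]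
  exact (h2.memLp_fst.add (memLp_const c)).integrable_sq.add
    (h2.memLp_snd.add (memLp_const d)).integrable_sq

lemma integral_fst_sq_map_add [IsProbabilityMeasure F] (h2 : SqIntegrable F) (c d : ℝ) :
    ∫ p, p.1 ^ 2 ∂(F.map fun p => (p.1 + c, p.2 + d))
      = (∫ p, p.1 ^ 2 ∂F) + 2 * c * (∫ p, p.1 ∂F) + c ^ 2 := by
  rw [integral_map (by fun_prop) (by fun_prop)]
  have i1 := h2.memLp_fst.integrable_sq
  have i2 : Integrable (fun p : ℝ × ℝ => 2 * c * p.1) F :=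
    (h2.memLp_fst.integrable (by norm_num)).const_mul _
  have i3 : Integrable (fun p : ℝ × ℝ => p.1 ^ 2 + 2 * c * p.1) F := i1.add i2
  have e : ∀ p : ℝ × ℝ, (p.1 + c) ^ 2 = p.1 ^ 2 + 2 * c * p.1 + c ^ 2 := fun p => by ring
  simp_rw [e]
  rw [integral_add i3 (integrable_const _), integral_add i1 i2, integral_const_mul]
  simp

lemma integral_snd_sq_map_add [IsProbabilityMeasure F] (h2 : SqIntegrable F) (c d : ℝ) :
    ∫ p, p.2 ^ 2 ∂(F.map fun p => (p.1 + c, p.2 + d))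
      = (∫ p, p.2 ^ 2 ∂F) + 2 * d * (∫ p, p.2 ∂F) + d ^ 2 := by
  rw [integral_map (by fun_prop) (by fun_prop)]
  have i1 := h2.memLp_snd.integrable_sq
  have i2 : Integrable (fun p : ℝ × ℝ => 2 * d * p.2) F :=
    (h2.memLp_snd.integrable (by norm_num)).const_mul _
  have i3 : Integrable (fun p : ℝ × ℝ => p.2 ^ 2 + 2 * d * p.2) F := i1.add i2
  have e : ∀ p : ℝ × ℝ, (p.2 + d) ^ 2 = p.2 ^ 2 + 2 * d * p.2 + d ^ 2 := fun p => by ring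
  simp_rw [e]
  rw [integral_add i3 (integrable_const _), integral_add i1 i2, integral_const_mul]
  simp

lemma integral_mul_map_add [IsProbabilityMeasure F] (h2 : SqIntegrable F) (c d : ℝ) :
    ∫ p, p.1 * p.2 ∂(F.map fun p => (p.1 + c, p.2 + d))
      = (∫ p, p.1 * p.2 ∂F) + d * (∫ p, p.1 ∂F) + c * (∫ p, p.2 ∂F) + c * d := by
  rw [integral_map (by fun_prop) (by fun_prop)]
  have i0 := h2.integrable_mul
  have i1 : Integrable (fun p : ℝ × ℝ => d * p.1) F :=
    (h2.memLp_fst.integrable (by norm_num)).const_mul _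
  have i2 : Integrable (fun p : ℝ × ℝ => c * p.2) F :=
    (h2.memLp_snd.integrable (by norm_num)).const_mul _
  have i3 : Integrable (fun p : ℝ × ℝ => p.1 * p.2 + d * p.1) F := i0.add i1
  have i4 : Integrable (fun p : ℝ × ℝ => p.1 * p.2 + d * p.1 + c * p.2) F := i3.add i2
  have e : ∀ p : ℝ × ℝ, (p.1 + c) * (p.2 + d) = p.1 * p.2 + d * p.1 + c * p.2 + c * d :=
    fun p => by ring
  simp_rw [e]
  rw [integral_add i4 (integrable_const _), integral_add i3 i2, integral_add i0 i1,
    integral_const_mul, integral_const_mul]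
  simp

/-- Squaring removes the roots, so that a constant correlation becomes a polynomial identity in the
translation vector. -/
lemma integral_mul_sq_eq (hF : MemMc F) (h2 : SqIntegrable F) :
    (∫ p, p.1 * p.2 ∂F) ^ 2 = corr F ^ 2 * ((∫ p, p.1 ^ 2 ∂F) * ∫ p, p.2 ^ 2 ∂F) := by
  have s1 := scale₁_pos hF h2
  have s2 := scale₂_pos hF h2
  rw [← scale₁_sq, ← scale₂_sq, corr]
  field_simp

/-- Some translation by a vector with nonnegative coordinates changes the correlation. -/
lemma exists_corr_map_add_ne (hF : MemMc F) (h2 : SqIntegrable F) :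
    ∃ c d : ℝ, 0 ≤ c ∧ 0 ≤ d ∧ corr F ≠ corr (F.map fun p => (p.1 + c, p.2 + d)) := by
  have := hF.1
  by_contra! hc
  have key : ∀ c d : ℝ, 0 ≤ c → 0 ≤ d →
      ((∫ p, p.1 * p.2 ∂F) + d * (∫ p, p.1 ∂F) + c * (∫ p, p.2 ∂F) + c * d) ^ 2
      = corr F ^ 2 * (((∫ p, p.1 ^ 2 ∂F) + 2 * c * (∫ p, p.1 ∂F) + c ^ 2)
        * ((∫ p, p.2 ^ 2 ∂F) + 2 * d * (∫ p, p.2 ∂F) + d ^ 2)) := by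
    intro c d h h'
    have h3 := integral_mul_sq_eq (hF.map_add c d) (h2.map_add c d)
    rwa [← hc c d h h', integral_mul_map_add h2, integral_fst_sq_map_add h2,
      integral_snd_sq_map_add h2] at h3
  -- Translating by minus the mean turns positivity of the second moment into positivity of the
  -- variance of `Y`.
  have hvar := integral_snd_sq_pos (hF.map_add 0 (-∫ p, p.2 ∂F)) (h2.map_add _ _)
  rw [integral_snd_sq_map_add h2] at hvar
  -- Half the second difference at `0, 1, 2` extracts the coefficient of `c ^ 2`. The same in `d`
  -- then gives `ρ² = 1`, and `d = 0` yields `(E Y)² = E Y²`.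
  have hcoef : ∀ d : ℝ, 0 ≤ d → ((∫ p, p.2 ∂F) + d) ^ 2
      = corr F ^ 2 * ((∫ p, p.2 ^ 2 ∂F) + 2 * d * (∫ p, p.2 ∂F) + d ^ 2) := by
    intro d hd
    linear_combination (key 2 d zero_le_two hd - 2 * key 1 d zero_le_one hd
      + key 0 d le_rfl hd) / 2
  have hR : 1 = corr F ^ 2 := by
    linear_combination (hcoef 2 zero_le_two - 2 * hcoef 1 zero_le_one + hcoef 0 le_rfl) / 2
  have h0 := hcoef 0 le_rfl
  rw [← hR] at h0
  nlinarith

lemma HasCopula.map_add {C : Measure (ℝ × ℝ)} (h : HasCopula F C) (c d : ℝ) :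
    HasCopula (F.map fun p => (p.1 + c, p.2 + d)) C := by
  simpa using h.map_affine c d one_pos one_pos

lemma IsTheCopula.map_add {C : Measure (ℝ × ℝ)} (hF : MemMc F) (h : IsTheCopula F C) (c d : ℝ) :
    IsTheCopula (F.map fun p => (p.1 + c, p.2 + d)) C := by
  have hC := ((h C).2 rfl).map_add c d
  exact fun C' => ⟨fun h' => h'.unique (hF.map_add c d) hC, fun h' => h' ▸ hC⟩

lemma CopulasDiffer.symm {H K : Measure (ℝ × ℝ)} (h : CopulasDiffer H K) : CopulasDiffer K H :=
  ⟨h.2.1, h.1, fun C D hC hD => (h.2.2 D C hD hC).symm⟩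

/-! ### Separation of the copulas by the correlation. -/

/-- Distinct correlations are seen by the copulas of the compound Poisson distributions. -/
theorem copulas_separate_of_corr_ne {G : Measure (ℝ × ℝ)} (hF : MemMc F) (hF2 : SqIntegrable F)
    (hG : MemMc G) (hG2 : SqIntegrable G) (hne : corr F ≠ corr G) :
    ∃ Lam : ℝ, 0 < Lam ∧
      (∀ lam : ℝ, Lam ≤ lam → CopulasDiffer (Psi lam F) (Psi lam G)) ∧
      ∃ u₀ ∈ Ioo (0 : ℝ) 1, ∃ v₀ ∈ Ioo (0 : ℝ) 1, ∃ L : ℝ, 0 < L ∧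
        ∀ C D : ℝ → Measure (ℝ × ℝ),
          (∀ lam : ℝ, Lam ≤ lam → HasCopula (Psi lam F) (C lam)) →
          (∀ lam : ℝ, Lam ≤ lam → HasCopula (Psi lam G) (D lam)) →
          Tendsto (fun lam : ℝ => |distFun (C lam) u₀ v₀ - distFun (D lam) u₀ v₀|)
            atTop (𝓝 L) := by
  have := hF.1
  have := hG.1
  obtain ⟨x, y, hxy⟩ := exists_distFun_gaussPair_ne (corr_sq_le_one hF hF2)
    (corr_sq_le_one hG hG2) hne
  obtain ⟨e, he, hCe⟩ := exists_bound_distFun_copula hF hF2 x y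
  obtain ⟨f, hf, hDf⟩ := exists_bound_distFun_copula hG hG2 x y
  set u := (ProbabilityTheory.gaussianReal 0 1).real (Iic x)
  set v := (ProbabilityTheory.gaussianReal 0 1).real (Iic y)
  have hL := abs_pos.2 (sub_ne_zero.2 hxy)
  set L := |distFun (gaussPair (corr F)) x y - distFun (gaussPair (corr G)) x y| with hLdef
  have hef : Tendsto (fun lam => e lam + f lam) atTop (𝓝 0) := by simpa using he.add hf
  have hdist : ∀ lam > 0, ∀ C D, HasCopula (Psi lam F) C → HasCopula (Psi lam G) D →
      |(|distFun C u v - distFun D u v|) - L| ≤ e lam + f lam := by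
    intro lam hl C D hC hD
    refine (abs_abs_sub_abs_le_abs_sub _ _).trans ?_
    rw [sub_sub_sub_comm]
    exact (abs_sub _ _).trans (add_le_add (hCe lam hl C hC) (hDf lam hl D hD))
  -- Beyond `T` the total error is below `L`, whereas a common copula would make it at least `L`.
  -- The maximum with `1` keeps the intensity positive.
  obtain ⟨T, hT⟩ := eventually_atTop.1 (hef.eventually (gt_mem_nhds hL))
  refine ⟨max T 1, by positivity, fun lam hlam => ?_, u, gaussianReal_real_Iic_mem_Ioo x, v,
    gaussianReal_real_Iic_mem_Ioo y, L, hL, fun C D hC hD => ?_⟩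
  · have hl : 0 < lam := one_pos.trans_le ((le_max_right _ _).trans hlam)
    have := isProbabilityMeasure_Psi F hl.le
    have := isProbabilityMeasure_Psi G hl.le
    refine ⟨exists_hasCopula _, exists_hasCopula _, fun C D hC hD h => ?_⟩
    have h1 := hdist lam hl C D hC hD
    have h3 := hT lam ((le_max_left _ _).trans hlam)
    rw [h, sub_self, abs_zero, zero_sub, abs_neg, abs_of_pos hL] at h1
    linarith
  · rw [tendsto_iff_norm_sub_tendsto_zero]
    refine squeeze_zero' (Eventually.of_forall fun _ => norm_nonneg _) ?_ hef
    filter_upwards [eventually_ge_atTop (max T 1)] with lam hlam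
    exact hdist lam (one_pos.trans_le ((le_max_right _ _).trans hlam)) _ _ (hC _ hlam) (hD _ hlam)

/-! ### The independence copula as a concrete example. -/

/-- A copula is its own copula. -/
lemma IsCopula.hasCopula_self {C : Measure (ℝ × ℝ)} (hC : IsCopula C) : HasCopula C C := by
  refine ⟨hC, fun x y => ?_⟩
  have hp := hC.1.1
  obtain ⟨h1, h2⟩ := isCopula_iff.1 hC
  have hae : ∀ᵐ t ∂unif, t ∈ Icc (0 : ℝ) 1 := ae_restrict_mem measurableSet_Icc
  -- The uniform distribution function is the identity only on `[0, 1]`. For `z < 0` its value is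
  -- `0`, and the two events then agree only after discarding the null set `{0}`.
  have hunif : ∀ z, ∀ᵐ t ∂unif, t ≤ z ↔ t ≤ unif.real (Iic z) := by
    intro z
    rcases lt_or_ge z 0 with hz | hz
    · have h0 : unif.real (Iic z) ≤ 0 := by
        rw [← unif_real_Iic (u := 0) (by simp)]
        exact measureReal_mono (Iic_subset_Iic.2 hz.le)
      have hne : ∀ᵐ t ∂unif, t ≠ 0 := by simp [ae_iff]
      filter_upwards [hae, hne] with t ht ht0
      have : 0 < t := lt_of_le_of_ne ht.1 (Ne.symm ht0)
      exact iff_of_false (by linarith) (by linarith)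
    rcases le_or_gt z 1 with hz1 | hz1
    · rw [unif_real_Iic ⟨hz, hz1⟩]; simp
    · have h0 : 1 ≤ unif.real (Iic z) := by
        rw [← unif_real_Iic (u := 1) (by simp)]
        exact measureReal_mono (Iic_subset_Iic.2 hz1.le)
      filter_upwards [hae] with t ht
      exact iff_of_true (ht.2.trans hz1.le) (ht.2.trans h0)
  rw [h1, h2]
  have a1 : ∀ᵐ p ∂C, p.1 ≤ x ↔ p.1 ≤ unif.real (Iic x) :=
    ae_of_ae_map (f := Prod.fst) measurable_fst.aemeasurable
      (show ∀ᵐ t ∂C.fst, t ≤ x ↔ t ≤ unif.real (Iic x) by rw [h1]; exact hunif x)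
  have a2 : ∀ᵐ p ∂C, p.2 ≤ y ↔ p.2 ≤ unif.real (Iic y) :=
    ae_of_ae_map (f := Prod.snd) measurable_snd.aemeasurable
      (show ∀ᵐ t ∂C.snd, t ≤ y ↔ t ≤ unif.real (Iic y) by rw [h2]; exact hunif y)
  refine measureReal_congr ?_
  filter_upwards [a1, a2] with p hp1 hp2
  apply propext
  change _ ∧ _ ↔ _ ∧ _
  exact and_congr hp1 hp2

/-- The independence copula. -/
lemma isCopula_unif_prod : IsCopula (unif.prod unif) :=
  isCopula_iff.2 ⟨by rw [Measure.fst_prod], by rw [Measure.snd_prod]⟩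

lemma ae_unif_prod_mem : ∀ᵐ p ∂unif.prod unif, p.1 ∈ Icc (0 : ℝ) 1 ∧ p.2 ∈ Icc (0 : ℝ) 1 := by
  have h : ∀ᵐ v ∂unif, v ∈ Icc (0 : ℝ) 1 := ae_restrict_mem measurableSet_Icc
  exact (Measure.quasiMeasurePreserving_fst.ae h).and (ae_snd_mem_Icc unif)

lemma memMcPlus_unif_prod : MemMcPlus (unif.prod unif) := by
  refine ⟨isCopula_unif_prod.1, ?_⟩
  rw [measure_eq_zero_iff_ae_notMem]
  filter_upwards [ae_unif_prod_mem] with p hp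
  exact not_not.2 ⟨hp.1.1, hp.2.1⟩

lemma sqIntegrable_unif_prod : SqIntegrable (unif.prod unif) := by
  refine Integrable.of_bound (C := 2) (by fun_prop) ?_
  filter_upwards [ae_unif_prod_mem] with p hp
  rw [Real.norm_of_nonneg (by positivity)]
  nlinarith [hp.1.1, hp.1.2, hp.2.1, hp.2.2]

end CPPCopula

theorem corollary3p6 :
    (∀ F : Measure (ℝ × ℝ), CPPCopula.MemMc F → CPPCopula.SqIntegrable F →
      ∃ G : Measure (ℝ × ℝ),
        (∃ c d : ℝ, 0 ≤ c ∧ 0 ≤ d ∧ G = Measure.conv (Measure.dirac (c, d)) F) ∧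
        G ≠ F ∧ CPPCopula.MemMc G ∧ CPPCopula.SqIntegrable G ∧
        (CPPCopula.MemMcPlus F → CPPCopula.MemMcPlus G) ∧
        (∃ C : Measure (ℝ × ℝ), CPPCopula.IsTheCopula F C ∧ CPPCopula.IsTheCopula G C) ∧
        ∃ Lam : ℝ, 0 < Lam ∧
          (∀ lam : ℝ, Lam ≤ lam →
            CPPCopula.CopulasDiffer (CPPCopula.Psi lam F) (CPPCopula.Psi lam G)) ∧
          ∃ u₀ ∈ Ioo (0 : ℝ) 1, ∃ v₀ ∈ Ioo (0 : ℝ) 1, ∃ L : ℝ, 0 < L ∧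
            ∀ C D : ℝ → Measure (ℝ × ℝ),
              (∀ lam : ℝ, Lam ≤ lam → CPPCopula.HasCopula (CPPCopula.Psi lam F) (C lam)) →
              (∀ lam : ℝ, Lam ≤ lam → CPPCopula.HasCopula (CPPCopula.Psi lam G) (D lam)) →
              Tendsto
                (fun lam : ℝ =>
                  |CPPCopula.distFun (C lam) u₀ v₀ - CPPCopula.distFun (D lam) u₀ v₀|)
                atTop (𝓝 L)) ∧
    (∃ F : Measure (ℝ × ℝ), CPPCopula.MemMcPlus F ∧ CPPCopula.SqIntegrable F ∧
      ∃ C : Measure (ℝ × ℝ), CPPCopula.IsTheCopula F C ∧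
        ∃ Lam : ℝ, 0 < Lam ∧ ∀ lam : ℝ, Lam ≤ lam →
          CPPCopula.CopulasDiffer (CPPCopula.Psi lam F) (CPPCopula.Psi lam C)) := by
  refine ⟨fun F hF hF2 => ?_, ?_⟩
  · obtain ⟨c, d, hc, hd, hne⟩ := CPPCopula.exists_corr_map_add_ne hF hF2
    have := hF.1
    obtain ⟨C, hC⟩ := CPPCopula.exists_isTheCopula hF
    refine ⟨F.map fun p => (p.1 + c, p.2 + d),
      ⟨c, d, hc, hd, (CPPCopula.dirac_conv_eq c d).symm⟩, fun h => hne (by rw [h]),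
      hF.map_add c d, hF2.map_add c d, fun h => h.map_add hc hd, ⟨C, hC, hC.map_add hF c d⟩,
      CPPCopula.copulas_separate_of_corr_ne hF hF2 (hF.map_add c d) (hF2.map_add c d) hne⟩
  -- The counterexample is a translate of the independence copula: its copula is the untranslated
  -- law, of different correlation. The separation theorem is thus used with the roles exchanged.
  · have hU := CPPCopula.memMcPlus_unif_prod
    have hU2 := CPPCopula.sqIntegrable_unif_prod
    obtain ⟨c, d, hc, hd, hne⟩ := CPPCopula.exists_corr_map_add_ne hU.1 hU2
    have hself := CPPCopula.isCopula_unif_prod.hasCopula_self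
    have hthe : CPPCopula.IsTheCopula (CPPCopula.unif.prod CPPCopula.unif)
        (CPPCopula.unif.prod CPPCopula.unif) :=
      fun C => ⟨fun h => h.unique hU.1 hself, fun h => h ▸ hself⟩
    obtain ⟨Lam, hLam, hdiff, -⟩ := CPPCopula.copulas_separate_of_corr_ne hU.1 hU2
      (hU.1.map_add c d) (hU2.map_add c d) hne
    exact ⟨_, hU.map_add hc hd, hU2.map_add c d, _, hthe.map_add hU.1 c d, Lam, hLam,
      fun lam hlam => (hdiff lam hlam).symm⟩
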